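/- For an integer $n \ge 3$, let $\alpha(n)$ be the least number $k$ for which there exists a finite simple graph with $k$ vertices having precisely $n$ spanning trees, and let $\beta(n)$ be the least number $k$ for which there exists a finite simple graph with $k$ edges having precisely $n$ spanning trees (both exist, since the $n$-cycle has exactly $n$ spanning trees). Then $$\alpha(22) = \beta(22) = 22.$$ In particular, no simple graph with fewer than $22$ vertices has exactly $22$ spanning trees. -/

import Mathlib

/-- The number of spanning trees of a simple graph `G`: a spanning tree of `G` is a tree on the
whole vertex set of `G`, all of whose edges are edges of `G`. -/
noncomputable def numSpanningTrees {V : Type*} (G : SimpleGraph V) : ℕ :=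
  {T : SimpleGraph V | T ≤ G ∧ T.IsTree}.ncard

/-- `minVertices n` is `α(n)`: the least `k` for which some simple graph with `k` vertices has
precisely `n` spanning trees. It is only meaningful when such a `k` exists, as it does for
`3 ≤ n` (the `n`-cycle); a nonzero value is always attained. -/
noncomputable def minVertices (n : ℕ) : ℕ :=
  sInf {k : ℕ | ∃ G : SimpleGraph (Fin k), numSpanningTrees G = n}

/-- `minEdges n` is `β(n)`: the least `k` for which some (finite) simple graph with `k` edges has
precisely `n` spanning trees. It is only meaningful when such a `k` exists, as it does for
`3 ≤ n` (the `n`-cycle); a nonzero value is always attained. -/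
noncomputable def minEdges (n : ℕ) : ℕ :=
  sInf {k : ℕ | ∃ (m : ℕ) (G : SimpleGraph (Fin m)),
    G.edgeSet.ncard = k ∧ numSpanningTrees G = n}

/-! In a connected graph the complements of spanning trees are the information sets of the binary
cycle space (`numSpanningTrees_eq_card_infoSets`), and simplicity gives that code minimum weight
three (`minWeightThree_cycleSpace`). So the question concerns codes: 22 information sets force
dimension one (`finrank_eq_one_of_card_infoSets`). Such a graph has as many edges as vertices, and
its unique cycle has 22 edges. For the code, the double count `finrank_mul_card_infoSets` compares
`C` with its shortenings. It gives at least 24 information sets from dimension four on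
(`twentyFour_le_card_infoSets`). In dimensions two and three the columns of a generator matrix are
nonzero vectors with multiplicities, and the double count bounds the support enough for a finite
check in dimension three. -/

open Finset Module

/-! ### Information sets of binary codes and shortening. -/

section BinaryCode

variable {E : Type*}

/-- No nonzero word of `C` vanishes on `S`. -/
def Separates (C : Submodule (ZMod 2) (E → ZMod 2)) (S : Finset E) : Prop :=
  ∀ c ∈ C, (∀ e ∈ S, c e = 0) → c = 0

/-- The words of `C` that vanish at `e`. -/
def shorten (C : Submodule (ZMod 2) (E → ZMod 2)) (e : E) : Submodule (ZMod 2) (E → ZMod 2) :=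
  C ⊓ LinearMap.ker (LinearMap.proj e)

variable {C : Submodule (ZMod 2) (E → ZMod 2)}

lemma mem_shorten {e : E} {c : E → ZMod 2} : c ∈ shorten C e ↔ c ∈ C ∧ c e = 0 := by
  simp [shorten]

lemma shorten_le (e : E) : shorten C e ≤ C := inf_le_left

lemma Separates.erase [DecidableEq E] {S : Finset E} (h : Separates C S) (e : E) :
    Separates (shorten C e) (S.erase e) := by
  intro c hc hS
  rw [mem_shorten] at hc
  refine h c hc.1 fun f hf => ?_
  by_cases hfe : f = e
  · exact hfe ▸ hc.2
  · exact hS f (mem_erase.2 ⟨hfe, hf⟩)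

variable [Fintype E]

open Classical in
/-- The information sets of a binary code: the separating sets of size the dimension. -/
noncomputable def infoSets (C : Submodule (ZMod 2) (E → ZMod 2)) : Finset (Finset E) :=
  univ.filter fun S => S.card = finrank (ZMod 2) C ∧ Separates C S

open Classical in
/-- The coordinates on which some word of `C` is nonzero. -/
noncomputable def codeSupport (C : Submodule (ZMod 2) (E → ZMod 2)) : Finset E :=
  univ.filter fun e => ∃ c ∈ C, c e ≠ 0

/-- Every nonzero word of `C` has weight at least three. -/
def MinWeightThree (C : Submodule (ZMod 2) (E → ZMod 2)) : Prop :=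
  ∀ c ∈ C, c ≠ 0 → 3 ≤ (univ.filter fun e => c e ≠ 0).card

lemma mem_infoSets {S : Finset E} :
    S ∈ infoSets C ↔ S.card = finrank (ZMod 2) C ∧ Separates C S := by
  simp [infoSets]

lemma mem_codeSupport {e : E} : e ∈ codeSupport C ↔ ∃ c ∈ C, c e ≠ 0 := by
  simp [codeSupport]

lemma MinWeightThree.shorten (h : MinWeightThree C) (e : E) : MinWeightThree (shorten C e) :=
  fun c hc => h c (shorten_le e hc)

lemma Separates.finrank_le {S : Finset E} (h : Separates C S) :
    finrank (ZMod 2) C ≤ S.card := by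
  let f : C →ₗ[ZMod 2] (S → ZMod 2) := (LinearMap.funLeft (ZMod 2) (ZMod 2) Subtype.val) ∘ₗ C.subtype
  have hf : Function.Injective f := by
    rw [← LinearMap.ker_eq_bot, LinearMap.ker_eq_bot']
    intro c hc
    apply Subtype.ext
    exact h c c.2 fun e he => congrFun hc ⟨e, he⟩
  simpa using LinearMap.finrank_le_finrank_of_injective hf

lemma finrank_shorten_add_one {e : E} (he : e ∈ codeSupport C) :
    finrank (ZMod 2) (shorten C e) + 1 = finrank (ZMod 2) C := by
  obtain ⟨c, hc, hce⟩ := mem_codeSupport.1 he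
  let f : C →ₗ[ZMod 2] ZMod 2 := (LinearMap.proj e) ∘ₗ C.subtype
  have hf : f ≠ 0 := fun h => hce (LinearMap.congr_fun h ⟨c, hc⟩)
  have hmap : (LinearMap.ker f).map C.subtype = shorten C e := by
    ext d
    simp [f, mem_shorten, and_comm]
  rw [← hmap, Submodule.finrank_map_subtype_eq]
  have h1 := LinearMap.finrank_range_add_finrank_ker f
  rw [LinearMap.range_eq_top.2 (LinearMap.surjective hf), finrank_top, finrank_self] at h1
  omega

lemma shorten_of_notMem {e : E} (he : e ∉ codeSupport C) : shorten C e = C := by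
  ext c
  rw [mem_shorten, and_iff_left_iff_imp]
  intro hc
  by_contra h
  exact he (mem_codeSupport.2 ⟨c, hc, h⟩)

/-- A coordinate where all words vanish could be dropped, leaving a separating set smaller than the
dimension. -/
lemma mem_codeSupport_of_mem_infoSets {S : Finset E} (hS : S ∈ infoSets C) {e : E} (he : e ∈ S) :
    e ∈ codeSupport C := by
  classical
  rw [mem_infoSets] at hS
  by_contra h
  have h1 := (hS.2.erase e).finrank_le
  rw [shorten_of_notMem h, card_erase_of_mem he] at h1
  have := card_pos.2 ⟨e, he⟩
  omega

/-- Shortening is matroid contraction: deleting `e` matches the bases through `e` with the bases of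
the contraction. -/
lemma card_filter_mem_infoSets [DecidableEq E] {e : E} (he : e ∈ codeSupport C) :
    ((infoSets C).filter fun S => e ∈ S).card = (infoSets (shorten C e)).card := by
  have hr := finrank_shorten_add_one he
  have key : ∀ S ∈ infoSets (shorten C e), e ∉ S := by
    intro S hS h
    obtain ⟨c, hc, hce⟩ := mem_codeSupport.1 (mem_codeSupport_of_mem_infoSets hS h)
    exact hce (mem_shorten.1 hc).2
  refine card_bij' (fun S _ => S.erase e) (fun S _ => insert e S) ?_ ?_ ?_ ?_
  · intro S hS
    rw [mem_filter, mem_infoSets] at hS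
    rw [mem_infoSets, card_erase_of_mem hS.2]
    exact ⟨by omega, hS.1.2.erase e⟩
  · intro S hS
    have h := key S hS
    rw [mem_infoSets] at hS
    rw [mem_filter, mem_infoSets, card_insert_of_notMem h]
    refine ⟨⟨by omega, ?_⟩, mem_insert_self _ _⟩
    intro c hc hcS
    exact hS.2 c (mem_shorten.2 ⟨hc, hcS e (mem_insert_self _ _)⟩)
      fun f hf => hcS f (mem_insert_of_mem hf)
  · intro S hS
    exact insert_erase (mem_filter.1 hS).2
  · intro S hS
    exact erase_insert (key S hS)

/-- Double counting of the pairs of an information set and one of its elements. -/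
lemma finrank_mul_card_infoSets :
    finrank (ZMod 2) C * (infoSets C).card =
      ∑ e ∈ codeSupport C, (infoSets (shorten C e)).card := by
  classical
  have h1 : ∑ S ∈ infoSets C, S.card = finrank (ZMod 2) C * (infoSets C).card := by
    rw [sum_const_nat fun S hS => (mem_infoSets.1 hS).1, mul_comm]
  rw [← h1, ← sum_congr rfl fun e he => card_filter_mem_infoSets he]
  simp_rw [card_eq_sum_ones, sum_filter]
  rw [sum_comm]
  refine sum_congr rfl fun S hS => ?_
  rw [← sum_filter]
  refine sum_congr ?_ fun _ _ => rfl
  ext e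
  rw [mem_filter]
  exact ⟨fun h => ⟨mem_codeSupport_of_mem_infoSets hS h, h⟩, fun h => h.2⟩

lemma card_infoSets_of_finrank_eq_zero (h : finrank (ZMod 2) C = 0) : (infoSets C).card = 1 := by
  rw [card_eq_one]
  refine ⟨∅, ?_⟩
  ext S
  rw [mem_infoSets, h, card_eq_zero, mem_singleton, and_iff_left_iff_imp]
  rintro - c hc -
  rw [Submodule.finrank_eq_zero] at h
  simpa [h] using hc

lemma card_infoSets_of_finrank_eq_one (h : finrank (ZMod 2) C = 1) :
    (infoSets C).card = (codeSupport C).card := by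
  have h1 := finrank_mul_card_infoSets (C := C)
  rw [h, one_mul] at h1
  rw [h1, card_eq_sum_ones]
  refine sum_congr rfl fun e he => card_infoSets_of_finrank_eq_zero ?_
  have := finrank_shorten_add_one he
  omega

open Classical in
/-- The number of sequences of `n` coordinates on which no nonzero word of the code vanishes. -/
noncomputable def sepSeqCount : ℕ → Submodule (ZMod 2) (E → ZMod 2) → ℕ
  | 0, C => if C = ⊥ then 1 else 0
  | n + 1, C => ∑ e, sepSeqCount n (shorten C e)

/-- A separating sequence of length the dimension is an ordered information set. The iterated sum
can later be regrouped by columns of a generator matrix. -/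
lemma sepSeqCount_eq (n : ℕ) : ∀ C : Submodule (ZMod 2) (E → ZMod 2), n ≤ finrank (ZMod 2) C →
    sepSeqCount n C = if finrank (ZMod 2) C = n then n.factorial * (infoSets C).card else 0 := by
  classical
  induction n with
  | zero =>
    intro C _
    simp only [sepSeqCount, Submodule.finrank_eq_zero]
    split_ifs with h
    · rw [card_infoSets_of_finrank_eq_zero (Submodule.finrank_eq_zero.2 h), Nat.factorial_zero]
    · rfl
  | succ n ih =>
    intro C hC
    rw [sepSeqCount]
    split_ifs with h
    · rw [Nat.factorial_succ, mul_assoc, mul_left_comm, ← h, finrank_mul_card_infoSets, mul_sum,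
        ← sum_subset (subset_univ (codeSupport C))]
      · refine sum_congr rfl fun e he => ?_
        have := finrank_shorten_add_one he
        rw [ih _ (by omega), if_pos (by omega)]
      · intro e _ he
        rw [shorten_of_notMem he, ih _ (by omega), if_neg (by omega)]
    · refine sum_eq_zero fun e _ => ?_
      by_cases he : e ∈ codeSupport C
      · have := finrank_shorten_add_one he
        rw [ih _ (by omega), if_neg (by omega)]
      · rw [shorten_of_notMem he, ih _ (by omega), if_neg (by omega)]

end BinaryCode

/-! ### Codes of dimension two and three by column multiplicities, then all dimensions. -/

section SmallDimension

/-- The binary digits of `a`. -/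
def bitVec (n : ℕ) (a : Fin (2 ^ n)) (i : Fin n) : ZMod 2 :=
  ((finFunctionFinEquiv.symm a i).val : ZMod 2)

/-- The pairing of the binary expansions of `a` and `p`. -/
def bitDot (n : ℕ) (a p : Fin (2 ^ n)) : ZMod 2 :=
  ∑ i, bitVec n a i * bitVec n p i

/-- No nonzero `a` is orthogonal to all members of the list. -/
def BitSpanning (n : ℕ) (l : List (Fin (2 ^ n))) : Prop :=
  ∀ a, (∀ p ∈ l, bitDot n a p = 0) → a = ⟨0, by positivity⟩

instance (n : ℕ) (l : List (Fin (2 ^ n))) : Decidable (BitSpanning n l) := by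
  unfold BitSpanning; infer_instance

variable {E : Type*}

variable {C : Submodule (ZMod 2) (E → ZMod 2)}

/-- `w e` is the column at `e` of a generator matrix, so whether a word vanishes along `l` depends
only on the columns there. -/
lemma eq_bot_iff_bitSpanning {n : ℕ} {D : Submodule (ZMod 2) (E → ZMod 2)}
    {w : E → Fin (2 ^ n)} {cw : Fin (2 ^ n) ≃ C}
    (hw : ∀ a e, (cw a : E → ZMod 2) e = bitDot n a (w e)) (h0 : cw ⟨0, by positivity⟩ = 0)
    (l : List E) (hD : ∀ c, c ∈ D ↔ c ∈ C ∧ ∀ e ∈ l, c e = 0) :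
    D = ⊥ ↔ BitSpanning n (l.map w) := by
  rw [Submodule.eq_bot_iff]
  constructor
  · intro h a ha
    apply cw.injective
    rw [h0]
    apply Subtype.ext
    refine h _ ((hD _).2 ⟨(cw a).2, fun e he => ?_⟩)
    rw [hw]
    exact ha _ (List.mem_map_of_mem he)
  · intro h c hc
    obtain ⟨hc, hl⟩ := (hD c).1 hc
    obtain ⟨a, ha⟩ := cw.surjective ⟨c, hc⟩
    have hca : (cw a : E → ZMod 2) = c := by rw [ha]
    have : a = ⟨0, by positivity⟩ := by
      refine h a fun p hp => ?_
      obtain ⟨e, he, rfl⟩ := List.mem_map.1 hp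
      rw [← hw, hca, hl e he]
    rw [← hca, this, h0]
    rfl

variable [Fintype E]

lemma sum_comp_eq_sum_card_mul {n : ℕ} (w : E → Fin n) (F : Fin n → ℕ) :
    ∑ e, F (w e) = ∑ p, (univ.filter fun e => w e = p).card * F p := by
  rw [← Finset.sum_fiberwise univ w]
  refine sum_congr rfl fun p _ => ?_
  rw [sum_const_nat]
  intro e he
  rw [(mem_filter.1 he).2]

/-- The words and the coordinates of a code of dimension `n` labelled by bit strings. -/
lemma exists_bit_labelling {n : ℕ} (h : finrank (ZMod 2) C = n) :
    ∃ (w : E → Fin (2 ^ n)) (cw : Fin (2 ^ n) ≃ C),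
      (∀ a e, (cw a : E → ZMod 2) e = bitDot n a (w e)) ∧ cw ⟨0, by positivity⟩ = 0 := by
  let x := finBasisOfFinrankEq (ZMod 2) C h
  obtain ⟨φ, hφ⟩ : ∃ φ : Fin (2 ^ n) ≃ (Fin n → ZMod 2), ∀ a, φ a = bitVec n a := by
    refine ⟨(finFunctionFinEquiv.symm : Fin (2 ^ n) ≃ (Fin n → Fin 2)), fun a => funext fun i => ?_⟩
    have key : ∀ y : Fin 2, (show ZMod 2 from y) = (y.val : ZMod 2) := by decide
    exact key (finFunctionFinEquiv.symm a i)
  refine ⟨fun e => φ.symm fun i => (x i : E → ZMod 2) e, φ.trans x.equivFun.symm.toEquiv, ?_, ?_⟩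
  · intro a e
    simp only [bitDot, ← hφ, Equiv.apply_symm_apply]
    simp [Basis.equivFun_symm_apply]
  · have h0 : φ ⟨0, by positivity⟩ = 0 := by
      rw [hφ]
      funext i
      simp [bitVec, finFunctionFinEquiv]
    rw [Equiv.trans_apply, h0]
    exact map_zero x.equivFun.symm

lemma MinWeightThree.le_sum {n : ℕ} (hC : MinWeightThree C)
    {w : E → Fin (2 ^ n)} {cw : Fin (2 ^ n) ≃ C}
    (hw : ∀ a e, (cw a : E → ZMod 2) e = bitDot n a (w e)) (h0 : cw ⟨0, by positivity⟩ = 0)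
    {a : Fin (2 ^ n)} (ha : a ≠ ⟨0, by positivity⟩) :
    3 ≤ ∑ p, (univ.filter fun e => w e = p).card * if bitDot n a p ≠ 0 then 1 else 0 := by
  rw [← sum_comp_eq_sum_card_mul w fun p => if bitDot n a p ≠ 0 then 1 else 0]
  rw [← card_filter]
  simp_rw [← hw]
  refine hC _ (cw a).2 fun h => ha (cw.injective ?_)
  rw [h0]
  exact Subtype.ext h

lemma card_codeSupport_eq_sum {n : ℕ}
    {w : E → Fin (2 ^ n)} {cw : Fin (2 ^ n) ≃ C}
    (hw : ∀ a e, (cw a : E → ZMod 2) e = bitDot n a (w e)) :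
    (codeSupport C).card = ∑ p, (univ.filter fun e => w e = p).card *
      if ∃ a, bitDot n a p ≠ 0 then 1 else 0 := by
  rw [← sum_comp_eq_sum_card_mul w fun p => if ∃ a, bitDot n a p ≠ 0 then 1 else 0,
    ← card_filter]
  congr 1
  ext e
  rw [mem_codeSupport, mem_filter]
  simp_rw [← hw]
  constructor
  · rintro ⟨c, hc, hce⟩
    obtain ⟨a, ha⟩ := cw.surjective ⟨c, hc⟩
    exact ⟨mem_univ _, a, by rwa [ha]⟩
  · rintro ⟨-, a, ha⟩
    exact ⟨_, (cw a).2, ha⟩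

lemma sum_bitSpanning_two (N : Fin (2 ^ 2) → ℕ) :
    ∑ p, N p * ∑ q, N q * (if BitSpanning 2 [p, q] then 1 else 0) =
      2 * (N 1 * N 2 + N 1 * N 3 + N 2 * N 3) := by
  have h : ∀ p q : Fin (2 ^ 2), BitSpanning 2 [p, q] ↔ p ≠ 0 ∧ q ≠ 0 ∧ p ≠ q := by
    decide +kernel
  simp only [h]
  change ∑ p : Fin 4, N p * ∑ q : Fin 4, N q * (if p ≠ 0 ∧ q ≠ 0 ∧ p ≠ q then 1 else 0) = _
  simp [Fin.sum_univ_four]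
  ring

lemma sum_bitDot_two (N : Fin (2 ^ 2) → ℕ) (a : Fin (2 ^ 2)) :
    ∑ p, N p * (if bitDot 2 a p ≠ 0 then 1 else 0) =
      ∑ p : Fin 4, N p * (if (a = 1 ∧ (p = 1 ∨ p = 3)) ∨ (a = 2 ∧ (p = 2 ∨ p = 3)) ∨
        (a = 3 ∧ (p = 1 ∨ p = 2)) then 1 else 0) := by
  refine sum_congr rfl fun p _ => ?_
  congr 2
  revert a p
  decide +kernel

/-- The number of bases of the Fano matroid with points of the given multiplicities. -/
def fanoBases (a b c d e f g : ℕ) : ℕ :=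
  (a * b + a * c + b * c) * (d + e + f + g) + a * (d + e) * (f + g) + b * (d + f) * (e + g) +
    c * (d + g) * (e + f) + d * e * (f + g) + f * g * (d + e)

lemma sum_bitSpanning_three (N : Fin (2 ^ 3) → ℕ) :
    ∑ p, N p * ∑ q, N q * ∑ r, N r * (if BitSpanning 3 [p, q, r] then 1 else 0) =
      6 * fanoBases (N 1) (N 2) (N 3) (N 4) (N 5) (N 6) (N 7) := by
  -- Over the field of two elements, the only nontrivial relation among three distinct nonzero
  -- vectors is that they sum to zero.
  have h : ∀ p q r : Fin (2 ^ 3), BitSpanning 3 [p, q, r] ↔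
      p ≠ 0 ∧ q ≠ 0 ∧ r ≠ 0 ∧ p ≠ q ∧ p ≠ r ∧ q ≠ r ∧ p.val ^^^ q.val ≠ r.val := by
    decide +kernel
  simp only [h]
  change ∑ p : Fin 8, N p * ∑ q : Fin 8, N q * ∑ r : Fin 8, N r *
    (if p ≠ 0 ∧ q ≠ 0 ∧ r ≠ 0 ∧ p ≠ q ∧ p ≠ r ∧ q ≠ r ∧ p.val ^^^ q.val ≠ r.val then 1 else 0) = _
  simp [Fin.sum_univ_eight, fanoBases]
  ring

/-- The condition that the weights on the complement of each line of the Fano plane add up to at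
least three. -/
def FanoHeavy (a b c d e f g : ℕ) : Prop :=
  3 ≤ a + c + e + g ∧ 3 ≤ b + c + f + g ∧ 3 ≤ a + b + e + f ∧ 3 ≤ d + e + f + g ∧
    3 ≤ a + c + d + f ∧ 3 ≤ b + c + d + e ∧ 3 ≤ a + b + d + g

instance (a b c d e f g : ℕ) : Decidable (FanoHeavy a b c d e f g) := by
  unfold FanoHeavy; infer_instance

-- Total weight at most eight suffices: 22 information sets in dimension three give `8 * |support| ≤
-- 66`.
set_option synthInstance.maxHeartbeats 400000 in
set_option synthInstance.maxSize 100000 in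
lemma fanoBases_ne : ∀ a < 9, ∀ b < 9 - a, ∀ c < 9 - a - b, ∀ d < 9 - a - b - c,
    ∀ e < 9 - a - b - c - d, ∀ f < 9 - a - b - c - d - e, ∀ g < 9 - a - b - c - d - e - f,
    ¬ (FanoHeavy a b c d e f g ∧ fanoBases a b c d e f g = 22) := by
  decide +kernel

lemma sum_bitDot_three (N : Fin (2 ^ 3) → ℕ) (a : Fin (2 ^ 3)) :
    ∑ p, N p * (if bitDot 3 a p ≠ 0 then 1 else 0) =
      ∑ p : Fin 8, N p * (if (a.val.testBit 0 && p.val.testBit 0) ^^ (a.val.testBit 1 && p.val.testBit 1)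
        ^^ (a.val.testBit 2 && p.val.testBit 2) then 1 else 0) := by
  refine sum_congr rfl fun p _ => ?_
  congr 2
  revert a p
  decide +kernel

lemma exists_weights_of_finrank_eq_two (h : finrank (ZMod 2) C = 2) (hC : MinWeightThree C) :
    ∃ a b c : ℕ, 3 ≤ a + b ∧ 3 ≤ a + c ∧ 3 ≤ b + c ∧
      (infoSets C).card = a * b + a * c + b * c := by
  classical
  obtain ⟨w, cw, hw, h0⟩ := exists_bit_labelling h
  have hcount := sepSeqCount_eq 2 C h.ge
  rw [if_pos h] at hcount
  have h2 : sepSeqCount 2 C =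
      ∑ e, ∑ f, if BitSpanning 2 [w e, w f] then 1 else 0 := by
    simp only [sepSeqCount]
    refine sum_congr rfl fun e _ => sum_congr rfl fun f _ => ?_
    refine if_congr (eq_bot_iff_bitSpanning hw h0 [e, f] fun c => ?_) rfl rfl
    simp [mem_shorten, and_assoc]
  rw [h2, sum_comp_eq_sum_card_mul w fun p => ∑ f, if BitSpanning 2 [p, w f] then 1 else 0] at hcount
  simp_rw [fun p => sum_comp_eq_sum_card_mul w fun q => if BitSpanning 2 [p, q] then 1 else 0]
    at hcount
  have hd := fun a (ha : a ≠ ⟨0, by positivity⟩) => hC.le_sum hw h0 (a := a) ha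
  rw [sum_bitSpanning_two fun p => (univ.filter fun e => w e = p).card] at hcount
  simp_rw [sum_bitDot_two fun p => (univ.filter fun e => w e = p).card] at hd
  have h1 := hd 1 (by decide)
  have h2 := hd 2 (by decide)
  have h3 := hd 3 (by decide)
  simp [Fin.sum_univ_four] at h1 h2 h3
  exact ⟨_, _, _, h3, h1, h2, by simpa using hcount.symm⟩

lemma exists_weights_of_finrank_eq_three (h : finrank (ZMod 2) C = 3) (hC : MinWeightThree C) :
    ∃ a b c d e f g : ℕ, FanoHeavy a b c d e f g ∧
      (codeSupport C).card = a + b + c + d + e + f + g ∧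
      (infoSets C).card = fanoBases a b c d e f g := by
  classical
  obtain ⟨w, cw, hw, h0⟩ := exists_bit_labelling h
  have hcount := sepSeqCount_eq 3 C h.ge
  rw [if_pos h] at hcount
  have h2 : sepSeqCount 3 C =
      ∑ e, ∑ f, ∑ g, if BitSpanning 3 [w e, w f, w g] then 1 else 0 := by
    simp only [sepSeqCount]
    refine sum_congr rfl fun e _ => sum_congr rfl fun f _ => sum_congr rfl fun g _ => ?_
    refine if_congr (eq_bot_iff_bitSpanning hw h0 [e, f, g] fun c => ?_) rfl rfl
    simp [mem_shorten, and_assoc]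
  rw [h2, sum_comp_eq_sum_card_mul w fun p => ∑ f, ∑ g, if BitSpanning 3 [p, w f, w g] then 1 else 0]
    at hcount
  simp_rw [fun p => sum_comp_eq_sum_card_mul w fun q => ∑ g,
    if BitSpanning 3 [p, q, w g] then 1 else 0] at hcount
  simp_rw [fun p q => sum_comp_eq_sum_card_mul w fun r =>
    if BitSpanning 3 [p, q, r] then 1 else 0] at hcount
  have hd := fun a (ha : a ≠ ⟨0, by positivity⟩) => hC.le_sum hw h0 (a := a) ha
  rw [sum_bitSpanning_three fun p => (univ.filter fun e => w e = p).card] at hcount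
  simp_rw [sum_bitDot_three fun p => (univ.filter fun e => w e = p).card] at hd
  have hs := card_codeSupport_eq_sum hw
  have hp : ∀ p : Fin (2 ^ 3), (∃ a, bitDot 3 a p ≠ 0) ↔ p ≠ 0 := by decide +kernel
  simp_rw [hp] at hs
  change _ = ∑ p : Fin 8, _ at hs
  have h1 := hd 1 (by decide)
  have h2 := hd 2 (by decide)
  have h3 := hd 3 (by decide)
  have h4 := hd 4 (by decide)
  have h5 := hd 5 (by decide)
  have h6 := hd 6 (by decide)
  have h7 := hd 7 (by decide)
  simp [Fin.sum_univ_eight, Nat.testBit, Nat.shiftRight_eq_div_pow] at h1 h2 h3 h4 h5 h6 h7 hs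
  have hb := Nat.eq_of_mul_eq_mul_left (by decide : 0 < 6) hcount
  refine ⟨_, _, _, _, _, _, _, ?_, hs, hb.symm⟩
  exact ⟨h1, h2, h3, h4, h5, h6, h7⟩

/-- The extremal multiplicities are 2, 2, 1, as for the complete graph on four vertices minus an
edge. -/
lemma eight_le_card_infoSets (h : finrank (ZMod 2) C = 2) (hC : MinWeightThree C) :
    8 ≤ (infoSets C).card := by
  obtain ⟨a, b, c, h1, h2, h3, h4⟩ := exists_weights_of_finrank_eq_two h hC
  rw [h4]
  rcases Nat.lt_or_ge a 2 with ha | ha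
  · have hb : 2 ≤ b := by omega
    have hc : 2 ≤ c := by omega
    interval_cases a
    · nlinarith
    · nlinarith
  · rcases Nat.lt_or_ge b 2 with hb | hb
    · interval_cases b
      · nlinarith
      · nlinarith
    · rcases Nat.lt_or_ge c 2 with hc | hc
      · interval_cases c
        · nlinarith
        · nlinarith
      · nlinarith

lemma card_infoSets_ne_of_finrank_eq_two (h : finrank (ZMod 2) C = 2) (hC : MinWeightThree C) :
    (infoSets C).card ≠ 22 := by
  obtain ⟨a, b, c, h1, h2, h3, h4⟩ := exists_weights_of_finrank_eq_two h hC
  rw [h4]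
  intro h5
  -- Since `a * (b + c) ≤ 22` and `b + c ≥ 3`.
  have ha : a < 8 := by nlinarith
  have hb : b < 8 := by nlinarith
  have hc : c < 8 := by nlinarith
  have key : ∀ a < 8, ∀ b < 8, ∀ c < 8,
      ¬ (3 ≤ a + b ∧ 3 ≤ a + c ∧ 3 ≤ b + c ∧ a * b + a * c + b * c = 22) := by decide +kernel
  exact key a ha b hb c hc ⟨h1, h2, h3, h5⟩

/-- Each point of the Fano plane lies off four of the seven lines, so four times the total weight is
at least 21. -/
lemma six_le_card_codeSupport (h : finrank (ZMod 2) C = 3) (hC : MinWeightThree C) :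
    6 ≤ (codeSupport C).card := by
  obtain ⟨a, b, c, d, e, f, g, h1, h2, -⟩ := exists_weights_of_finrank_eq_three h hC
  unfold FanoHeavy at h1
  omega

lemma eight_mul_card_codeSupport_le (h : finrank (ZMod 2) C = 3) (hC : MinWeightThree C) :
    8 * (codeSupport C).card ≤ 3 * (infoSets C).card := by
  have h1 := finrank_mul_card_infoSets (C := C)
  rw [h] at h1
  rw [h1, mul_comm, ← smul_eq_mul]
  refine card_nsmul_le_sum _ _ _ fun e he => eight_le_card_infoSets ?_ (hC.shorten e)
  have := finrank_shorten_add_one he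
  omega

lemma card_infoSets_ne_of_finrank_eq_three (h : finrank (ZMod 2) C = 3) (hC : MinWeightThree C) :
    (infoSets C).card ≠ 22 := by
  have h1 := eight_mul_card_codeSupport_le h hC
  obtain ⟨a, b, c, d, e, f, g, h2, h3, h4⟩ := exists_weights_of_finrank_eq_three h hC
  intro h5
  refine fanoBases_ne a (by omega) b (by omega) c (by omega) d (by omega) e (by omega)
    f (by omega) g (by omega) ⟨h2, h4.symm.trans h5⟩

lemma codeSupport_mono {D : Submodule (ZMod 2) (E → ZMod 2)} (h : D ≤ C) :
    codeSupport D ⊆ codeSupport C := by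
  intro e
  rw [mem_codeSupport, mem_codeSupport]
  exact fun ⟨c, hc, hce⟩ => ⟨c, h hc, hce⟩

lemma finrank_le_card_codeSupport : finrank (ZMod 2) C ≤ (codeSupport C).card := by
  refine Separates.finrank_le fun c hc h => funext fun e => ?_
  by_contra hce
  exact hce (h e (mem_codeSupport.2 ⟨c, hc, hce⟩))

lemma twentyFour_le_card_infoSets (n : ℕ) : ∀ C : Submodule (ZMod 2) (E → ZMod 2),
    finrank (ZMod 2) C = n + 4 → MinWeightThree C → 24 ≤ (infoSets C).card := by
  induction n with
  | zero =>
    intro C h hC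
    have hr : ∀ e ∈ codeSupport C, finrank (ZMod 2) (shorten C e) = 3 := fun e he => by
      have := finrank_shorten_add_one he
      omega
    have hpos := finrank_le_card_codeSupport (C := C)
    obtain ⟨e, he⟩ : (codeSupport C).Nonempty := card_pos.1 (by omega)
    have h6 := (six_le_card_codeSupport (hr e he) (hC.shorten e)).trans
      (card_le_card (codeSupport_mono (shorten_le e)))
    have h1 := finrank_mul_card_infoSets (C := C)
    -- Each shortening has support at least 6, hence at least 16 information sets; then `4 * N ≥ 16
    -- * 6`.
    have h2 : (codeSupport C).card • 16 ≤ ∑ e ∈ codeSupport C, (infoSets (shorten C e)).card := by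
      refine card_nsmul_le_sum _ _ _ fun e he => ?_
      have h3 := six_le_card_codeSupport (hr e he) (hC.shorten e)
      have h4 := eight_mul_card_codeSupport_le (hr e he) (hC.shorten e)
      omega
    rw [← h1, h, smul_eq_mul] at h2
    omega
  | succ n ih =>
    intro C h hC
    have h1 := finrank_mul_card_infoSets (C := C)
    -- The support is at least as large as the dimension `r`, so `r * N ≥ 24 * r`.
    have h2 : (codeSupport C).card • 24 ≤ ∑ e ∈ codeSupport C, (infoSets (shorten C e)).card := by
      refine card_nsmul_le_sum _ _ _ fun e he => ih _ ?_ (hC.shorten e)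
      have := finrank_shorten_add_one he
      omega
    have h3 := finrank_le_card_codeSupport (C := C)
    rw [← h1, smul_eq_mul] at h2
    by_contra h4
    have h5 : 0 < finrank (ZMod 2) C := by omega
    nlinarith

/-- A binary code of minimum weight three with `22` information sets has dimension one. -/
theorem finrank_eq_one_of_card_infoSets (hC : MinWeightThree C) (h : (infoSets C).card = 22) :
    finrank (ZMod 2) C = 1 := by
  by_contra h1
  rcases Nat.lt_or_ge (finrank (ZMod 2) C) 4 with h4 | h4
  · interval_cases hr : finrank (ZMod 2) C
    · rw [card_infoSets_of_finrank_eq_zero hr] at h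
      omega
    · exact h1 rfl
    · exact card_infoSets_ne_of_finrank_eq_two hr hC h
    · exact card_infoSets_ne_of_finrank_eq_three hr hC h
  · have := twentyFour_le_card_infoSets (finrank (ZMod 2) C - 4) C (by omega) hC
    omega

end SmallDimension

/-! ### Spanning trees as information sets of the cycle space. -/

lemma connected_of_numSpanningTrees_ne_zero {V : Type*} {G : SimpleGraph V} (h : numSpanningTrees G ≠ 0) : G.Connected := by
  obtain ⟨T, hTG, hT⟩ := Set.nonempty_of_ncard_ne_zero h
  exact hT.connected.mono hTG

open Classical in
/-- The edges of `G` that are not edges of `T`. -/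
noncomputable def cotree {V : Type*} (G T : SimpleGraph V) [Fintype G.edgeSet] : Finset G.edgeSet :=
  univ.filter fun e => e.1 ∉ T.edgeSet

lemma mem_cotree {V : Type*} {G : SimpleGraph V} [Fintype G.edgeSet] {T : SimpleGraph V} {e : G.edgeSet} : e ∈ cotree G T ↔ e.1 ∉ T.edgeSet := by
  simp [cotree]

lemma card_cotree_add {V : Type*} {G : SimpleGraph V} [Fintype G.edgeSet] {T : SimpleGraph V} (hT : T ≤ G) :
    (cotree G T).card + Nat.card T.edgeSet = Fintype.card G.edgeSet := by
  classical
  have h1 := card_filter_add_card_filter_not (s := (univ : Finset G.edgeSet)) fun e => e.1 ∉ T.edgeSet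
  let f : {e : G.edgeSet // e.1 ∈ T.edgeSet} ≃ T.edgeSet :=
    { toFun := fun e => ⟨e.1.1, e.2⟩
      invFun := fun e => ⟨⟨e.1, SimpleGraph.edgeSet_mono hT e.2⟩, e.2⟩ }
  rw [← Nat.card_congr f, Nat.card_eq_fintype_card, Fintype.card_subtype, cotree, ← card_univ, ← h1]
  simp only [not_not]

lemma cotree_injective {V : Type*} {G : SimpleGraph V} [Fintype G.edgeSet]
    {T T' : SimpleGraph V} (hT : T ≤ G) (hT' : T' ≤ G)
    (h : cotree G T = cotree G T') : T = T' := by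
  rw [← SimpleGraph.edgeSet_inj]
  ext e
  by_cases he : e ∈ G.edgeSet
  · have h1 : (⟨e, he⟩ : G.edgeSet) ∈ cotree G T ↔ ⟨e, he⟩ ∈ cotree G T' := by rw [h]
    simpa only [mem_cotree, not_iff_not] using h1
  · exact iff_of_false (fun h => he (SimpleGraph.edgeSet_mono hT h))
      fun h => he (SimpleGraph.edgeSet_mono hT' h)

section CycleSpace

variable {V : Type*} [Fintype V] [DecidableEq V]

/-- The coboundary of a vertex function: its sum over the ends of an edge. -/
def coboundary (φ : V → ZMod 2) (e : Sym2 V) : ZMod 2 := ∑ v, if v ∈ e then φ v else 0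

lemma coboundary_mk (φ : V → ZMod 2) {x y : V} (h : x ≠ y) :
    coboundary φ s(x, y) = φ x + φ y := by
  rw [coboundary, ← sum_filter]
  have : (univ.filter fun v => v ∈ s(x, y)) = {x, y} := by ext; simp
  rw [this, sum_pair h]

variable (G : SimpleGraph V) [Fintype G.edgeSet]

/-- The boundary map over the field of two elements. -/
def boundary : (G.edgeSet → ZMod 2) →ₗ[ZMod 2] (V → ZMod 2) where
  toFun c v := ∑ e : G.edgeSet, if v ∈ e.1 then c e else 0
  map_add' c d := by
    funext v
    simp [← sum_add_distrib, ite_add_zero]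
  map_smul' r c := by
    funext v
    simp [mul_sum]

/-- The cycle space over the field of two elements. -/
def cycleSpace : Submodule (ZMod 2) (G.edgeSet → ZMod 2) := LinearMap.ker (boundary G)

variable {G}

lemma sum_mul_boundary (φ : V → ZMod 2) (c : G.edgeSet → ZMod 2) :
    ∑ v, φ v * boundary G c v = ∑ e : G.edgeSet, c e * coboundary φ e.1 := by
  simp only [boundary, LinearMap.coe_mk, AddHom.coe_mk, coboundary, mul_sum]
  rw [sum_comm]
  refine sum_congr rfl fun e _ => sum_congr rfl fun v _ => ?_
  split_ifs <;> ring

lemma sum_mul_coboundary_eq_zero {c : G.edgeSet → ZMod 2} (hc : c ∈ cycleSpace G)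
    (φ : V → ZMod 2) : ∑ e : G.edgeSet, c e * coboundary φ e.1 = 0 := by
  rw [← sum_mul_boundary, show boundary G c = 0 from hc]
  simp

/-- Each end of an edge in the support meets another such edge; these two differ, since no two edges
share both ends. -/
lemma minWeightThree_cycleSpace : MinWeightThree (cycleSpace G) := by
  intro c hc hne
  have hend : ∀ (v : V) (e : G.edgeSet), v ∈ e.1 → c e ≠ 0 → ∃ f : G.edgeSet, f ≠ e ∧ v ∈ f.1 ∧ c f ≠ 0 := by
    intro v e hv hce
    by_contra! h
    have h1 : boundary G c v = 0 := congrFun (show boundary G c = 0 from hc) v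
    have h2 : boundary G c v = c e := by
      change (∑ f : G.edgeSet, if v ∈ f.1 then c f else 0) = c e
      rw [sum_eq_single e]
      · rw [if_pos hv]
      · intro f _ hf
        split_ifs with hvf
        · exact h f hf hvf
        · rfl
      · simp
    exact hce (h2.symm.trans h1)
  obtain ⟨⟨e, he⟩, hce⟩ := Function.ne_iff.1 hne
  induction e with
  | h x y =>
  have hxy : x ≠ y := G.ne_of_adj he
  obtain ⟨f, hfe, hxf, hcf⟩ := hend x _ (Sym2.mem_mk_left x y) hce
  obtain ⟨g, hge, hyg, hcg⟩ := hend y _ (Sym2.mem_mk_right x y) hce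
  have hfg : f ≠ g := by
    rintro rfl
    exact hfe (Subtype.ext ((Sym2.mem_and_mem_iff hxy).1 ⟨hxf, hyg⟩))
  rw [← card_eq_three.2 ⟨_, _, _, hfe, hfg, hge.symm, rfl⟩]
  refine card_le_card fun z hz => ?_
  simp only [mem_insert, mem_singleton] at hz
  rw [mem_filter]
  rcases hz with rfl | rfl | rfl <;> exact ⟨mem_univ _, ‹_›⟩

/-- Every boundary has coordinate sum zero, so the boundary map has rank less than `|V|`. -/
lemma card_edgeSet_add_one_le [Nonempty V] :
    Fintype.card G.edgeSet + 1 ≤ finrank (ZMod 2) (cycleSpace G) + Fintype.card V := by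
  let s : (V → ZMod 2) →ₗ[ZMod 2] ZMod 2 := ∑ v, LinearMap.proj v
  have hs : Function.Surjective s := by
    obtain ⟨v⟩ := ‹Nonempty V›
    intro r
    refine ⟨Pi.single v r, ?_⟩
    simp [s, LinearMap.sum_apply]
  have hle : LinearMap.range (boundary G) ≤ LinearMap.ker s := by
    rintro _ ⟨c, rfl⟩
    have h := sum_mul_boundary (fun _ => 1) c
    rw [LinearMap.mem_ker]
    simp only [one_mul] at h
    simp only [s, LinearMap.sum_apply, LinearMap.proj_apply]
    rw [h]
    refine sum_eq_zero fun e _ => ?_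
    obtain ⟨e, he⟩ := e
    induction e with
    | h x y =>
    rw [coboundary_mk _ (G.ne_of_adj he), CharTwo.add_self_eq_zero, mul_zero]
  have h1 := LinearMap.finrank_range_add_finrank_ker (boundary G)
  have h2 := LinearMap.finrank_range_add_finrank_ker s
  have h3 := Submodule.finrank_mono hle
  rw [LinearMap.range_eq_top.2 hs, finrank_top, finrank_self, finrank_fintype_fun_eq_card] at h2
  rw [finrank_fintype_fun_eq_card] at h1
  unfold cycleSpace
  omega

lemma separates_of_isAcyclic {T : SimpleGraph V} (hT : T.IsAcyclic) :
    Separates (cycleSpace G) (cotree G T) := by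
  classical
  intro c hc h
  funext ⟨e, he⟩
  by_cases heT : e ∈ T.edgeSet
  swap
  · exact h _ (mem_cotree.2 heT)
  have hb := SimpleGraph.isAcyclic_iff_forall_isBridge.1 hT heT
  induction e with
  | h x y =>
  rw [SimpleGraph.isBridge_iff] at hb
  -- The indicator of one side of the cut made by removing the bridge: no other edge of `T` crosses
  -- it, so pairing its coboundary with `c` isolates `c` at that edge.
  let φ : V → ZMod 2 := fun v => if (T.deleteEdges {s(x, y)}).Reachable x v then 1 else 0
  have h1 := sum_mul_coboundary_eq_zero hc φ
  rw [sum_eq_single ⟨s(x, y), he⟩] at h1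
  · rw [coboundary_mk _ (G.ne_of_adj he)] at h1
    simpa [φ, hb] using h1
  · rintro ⟨f, hf⟩ _ hfe
    by_cases hfT : f ∈ T.edgeSet
    · induction f with
      | h u v =>
      rw [coboundary_mk _ (G.ne_of_adj hf)]
      have hadj : (T.deleteEdges {s(x, y)}).Adj u v := by
        rw [SimpleGraph.deleteEdges_adj]
        exact ⟨hfT, fun h => hfe (Subtype.ext h)⟩
      have : φ u = φ v := by
        simp only [φ]
        exact if_congr ⟨fun h => h.trans hadj.reachable, fun h => h.trans hadj.symm.reachable⟩ rfl rfl
      rw [this, CharTwo.add_self_eq_zero, mul_zero]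
    · rw [h _ (mem_cotree.2 hfT), zero_mul]
  · simp

/-- A cycle of `T` would give a nonzero word vanishing on the cotree. -/
lemma isAcyclic_of_separates {T : SimpleGraph V} (hT : T ≤ G)
    (h : Separates (cycleSpace G) (cotree G T)) : T.IsAcyclic := by
  classical
  intro v p hp
  let c : G.edgeSet → ZMod 2 := fun e => if e.1 ∈ p.edges then 1 else 0
  have hc : c ∈ cycleSpace G := by
    rw [cycleSpace, LinearMap.mem_ker]
    funext x
    have h1 := (hp.isTrail.even_countP_edges_iff x).2 (by simp)
    have h2 : boundary G c x = (p.edges.countP (x ∈ ·) : ZMod 2) := by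
      change (∑ e : G.edgeSet, if x ∈ e.1 then if e.1 ∈ p.edges then (1 : ZMod 2) else 0 else 0) = _
      simp_rw [← ite_and]
      rw [sum_boole, List.countP_eq_length_filter,
        ← List.toFinset_card_of_nodup (hp.isTrail.edges_nodup.filter _)]
      congr 1
      refine card_bij (fun e _ => e.1) ?_ (fun _ _ _ _ => Subtype.ext) ?_
      · intro e he
        simp only [mem_filter, mem_univ, true_and] at he
        simpa using he.symm
      · intro e he
        simp only [List.mem_toFinset, List.mem_filter, decide_eq_true_eq] at he
        exact ⟨⟨e, SimpleGraph.edgeSet_mono hT (p.edges_subset_edgeSet he.1)⟩, by simp [he], rfl⟩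
    rw [h2]
    exact (ZMod.natCast_eq_zero_iff_even).2 h1
  have h0 := h c hc fun e he => if_neg fun hep => mem_cotree.1 he (p.edges_subset_edgeSet hep)
  obtain ⟨e, he⟩ : ∃ e, e ∈ p.edges := by
    refine List.exists_mem_of_length_pos ?_
    have := hp.three_le_length
    rw [SimpleGraph.Walk.length_edges]
    omega
  have h2 := congrFun h0 ⟨e, SimpleGraph.edgeSet_mono hT (p.edges_subset_edgeSet he)⟩
  simp [c, he] at h2

lemma finrank_cycleSpace_add (hG : G.Connected) :
    finrank (ZMod 2) (cycleSpace G) + Fintype.card V = Fintype.card G.edgeSet + 1 := by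
  have := hG.nonempty
  obtain ⟨T, hTG, hT⟩ := hG.exists_isTree_le
  have h1 := (separates_of_isAcyclic (G := G) hT.isAcyclic).finrank_le
  have h2 := card_cotree_add hTG
  have h3 := (SimpleGraph.isTree_iff_connected_and_card.1 hT).2
  have h4 := card_edgeSet_add_one_le (G := G)
  rw [Nat.card_eq_fintype_card (α := V)] at h3
  omega

lemma isTree_iff_cotree_mem_infoSets (hG : G.Connected) {T : SimpleGraph V} (hT : T ≤ G) :
    T.IsTree ↔ cotree G T ∈ infoSets (cycleSpace G) := by
  have h1 := card_cotree_add hT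
  have h2 := finrank_cycleSpace_add hG
  rw [mem_infoSets]
  constructor
  · intro h
    have h3 := (SimpleGraph.isTree_iff_connected_and_card.1 h).2
    rw [Nat.card_eq_fintype_card (α := V)] at h3
    exact ⟨by omega, separates_of_isAcyclic h.isAcyclic⟩
  · rintro ⟨h3, h4⟩
    -- An acyclic `T` extends to a spanning tree; equal cotree sizes force equality.
    obtain ⟨T', hTT', hT'G, hT'⟩ := hG.exists_isTree_le_of_le_of_isAcyclic hT (isAcyclic_of_separates hT h4)
    have h5 := (SimpleGraph.isTree_iff_connected_and_card.1 hT').2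
    rw [Nat.card_eq_fintype_card (α := V)] at h5
    have h6 := card_cotree_add hT'G
    have h7 : cotree G T' ⊆ cotree G T := fun e he =>
      mem_cotree.2 fun h => mem_cotree.1 he (SimpleGraph.edgeSet_mono hTT' h)
    rwa [cotree_injective hT hT'G (eq_of_subset_of_card_le h7 (by omega)).symm]

lemma numSpanningTrees_eq_card_infoSets (hG : G.Connected) :
    numSpanningTrees G = (infoSets (cycleSpace G)).card := by
  rw [numSpanningTrees, ← Set.ncard_coe_finset]
  refine Set.ncard_congr (fun T _ => cotree G T) ?_ ?_ ?_
  · rintro T ⟨hTG, hT⟩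
    exact (isTree_iff_cotree_mem_infoSets hG hTG).1 hT
  · rintro T T' ⟨hTG, -⟩ ⟨hTG', -⟩ h
    exact cotree_injective hTG hTG' h
  · intro S hS
    let T := SimpleGraph.fromEdgeSet {e | ∃ h : e ∈ G.edgeSet, (⟨e, h⟩ : G.edgeSet) ∉ S}
    have hTe : ∀ e : G.edgeSet, e.1 ∈ T.edgeSet ↔ e ∉ S := by
      rintro ⟨e, he⟩
      simp only [T, SimpleGraph.edgeSet_fromEdgeSet, Set.mem_sdiff, Set.mem_ofPred_eq]
      exact ⟨fun h => h.1.2, fun h => ⟨⟨he, h⟩, G.not_isDiag_of_mem_edgeSet he⟩⟩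
    have hTG : T ≤ G := by
      intro x y h
      exact ((SimpleGraph.fromEdgeSet_adj _).1 h).1.1
    have hTS : cotree G T = S := by
      ext e
      rw [mem_cotree, hTe, not_not]
    exact ⟨T, ⟨hTG, (isTree_iff_cotree_mem_infoSets hG hTG).2 (hTS ▸ hS)⟩, hTS⟩

end CycleSpace

/-! ### Lower bounds for graphs, and the cycle attaining them. -/

/-- A graph with exactly `22` spanning trees has as many edges as vertices, and at least `22`. -/
theorem card_edgeSet_of_numSpanningTrees_eq {V : Type*} [Fintype V] {G : SimpleGraph V}
    (h : numSpanningTrees G = 22) :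
    22 ≤ G.edgeSet.ncard ∧ Fintype.card V = G.edgeSet.ncard := by
  classical
  have hG : G.Connected := connected_of_numSpanningTrees_ne_zero (by omega)
  rw [numSpanningTrees_eq_card_infoSets hG] at h
  have h1 := finrank_eq_one_of_card_infoSets minWeightThree_cycleSpace h
  rw [card_infoSets_of_finrank_eq_one h1] at h
  have h2 := finrank_cycleSpace_add hG
  have h3 := card_le_univ (codeSupport (cycleSpace G))
  rw [← Nat.card_coe_set_eq, Nat.card_eq_fintype_card]
  omega

lemma card_edgeSet_cycleGraph (n : ℕ) :
    Fintype.card (SimpleGraph.cycleGraph (n + 3)).edgeSet = n + 3 := by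
  have h := (SimpleGraph.cycleGraph (n + 3)).sum_degrees_eq_twice_card_edges
  simp only [SimpleGraph.cycleGraph_degree_three_le, sum_const, card_univ, Fintype.card_fin,
    smul_eq_mul] at h
  rw [SimpleGraph.edgeFinset_card] at h
  omega

/-- The cycle on `n` vertices has `n` spanning trees. -/
theorem numSpanningTrees_cycleGraph (n : ℕ) :
    numSpanningTrees (SimpleGraph.cycleGraph (n + 3)) = n + 3 := by
  have hG : (SimpleGraph.cycleGraph (n + 3)).Connected := SimpleGraph.cycleGraph_connected
  have h1 := finrank_cycleSpace_add hG
  rw [card_edgeSet_cycleGraph, Fintype.card_fin] at h1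
  rw [numSpanningTrees_eq_card_infoSets hG, card_infoSets_of_finrank_eq_one (by omega)]
  -- All degrees are two, so the all-ones word is a cycle and the support is the whole edge set.
  have hone : (fun _ => 1) ∈ cycleSpace (SimpleGraph.cycleGraph (n + 3)) := by
    rw [cycleSpace, LinearMap.mem_ker]
    funext v
    have h2 := SimpleGraph.cycleGraph_degree_three_le (v := v)
    rw [← SimpleGraph.card_incidenceFinset_eq_degree] at h2
    change (∑ e : (SimpleGraph.cycleGraph (n + 3)).edgeSet, if v ∈ e.1 then (1 : ZMod 2) else 0) = 0
    rw [sum_boole]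
    have h3 : (univ.filter fun e : (SimpleGraph.cycleGraph (n + 3)).edgeSet => v ∈ e.1).card = 2 := by
      rw [← h2]
      refine card_bij (fun e _ => e.1) ?_ (fun _ _ _ _ => Subtype.ext) ?_
      · intro e he
        rw [SimpleGraph.mem_incidenceFinset]
        exact ⟨e.2, (mem_filter.1 he).2⟩
      · intro e he
        rw [SimpleGraph.mem_incidenceFinset] at he
        exact ⟨⟨e, he.1⟩, by simpa using he.2, rfl⟩
    rw [h3]
    rfl
  have hs : codeSupport (cycleSpace (SimpleGraph.cycleGraph (n + 3))) = univ :=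
    eq_univ_of_forall fun e => mem_codeSupport.2 ⟨_, hone, one_ne_zero⟩
  rw [hs, card_univ, card_edgeSet_cycleGraph]

theorem mainTheorem2 : minVertices 22 = 22 ∧ minEdges 22 = 22 := by
  -- The cycle lemma is indexed by `n + 3`, so 19 gives the 22-cycle.
  have hcycle := numSpanningTrees_cycleGraph 19
  constructor
  · refine IsLeast.csInf_eq ⟨⟨_, hcycle⟩, ?_⟩
    rintro k ⟨G, hG⟩
    have h := card_edgeSet_of_numSpanningTrees_eq hG
    rw [Fintype.card_fin] at h
    omega
  · refine IsLeast.csInf_eq ⟨⟨_, _, ?_, hcycle⟩, ?_⟩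
    · rw [← Nat.card_coe_set_eq, Nat.card_eq_fintype_card, card_edgeSet_cycleGraph]
    · rintro k ⟨m, G, rfl, hG⟩
      exact (card_edgeSet_of_numSpanningTrees_eq hG).1
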